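/- Let $W_2^1=W_2^1[0,1]$ be the complex Sobolev space of absolutely continuous functions on $[0,1]$ with derivative in $L_2[0,1]$, and $W_2^2=W_2^2[0,1]$ the space of $y\in C^1[0,1]$ with $y'\in W_2^1$, with their usual norms. Let $W_2^{-1}$ and $W_2^{-2}$ be the spaces of bounded antilinear functionals on $W_2^1$ and $W_2^2$; write $\langle F,z\rangle$ for the value of $F$ at $z$. A functional $q\in W_2^{-1}$ is called real if it takes real values at real-valued functions. A real-valued function on $[0,1]$ has at most $n$ sign changes ($n=0,1,2,\dots$) if there are no points $\xi_0<\xi_1<\dots<\xi_{n+1}$ in $[0,1]$ with $f(\xi_k)f(\xi_{k+1})<0$ for all $k=0,\dots,n$. A functional $F\in W_2^{-2}$ has at most $n$ sign changes if it lies in the closure, in the norm of $W_2^{-2}$, of the set of functionals $z\mapsto\int_0^1 f\,\overline z\,dx$ with $f\in C[0,1]$ real-valued with at most $n$ sign changes. In both cases the number of sign changes is the least such $n$ (and $+\infty$ if there is none). Let $p\in L_\infty[0,1]$ be real-valued and uniformly positive (that is, $p\ge c$ almost everywhere for some $c>0$), let $q\in W_2^{-1}$ be real, let $\alpha>0$,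 and let the bounded linear operator $L\colon W_2^2\to W_2^{-2}$ be given by the identity $$\langle Ly,z\rangle=\int_0^1 p\,y''\,\overline{z''}\,dx+\langle q,\overline{y'}z'\rangle+\alpha\,y(0)\,\overline{z(0)}\qquad(y,z\in W_2^2).$$ Suppose that $L$ is positive, that is, $\langle Ly,y\rangle>0$ for every $y\in W_2^2$ with $y\ne0$. Then $L$ does not decrease the number of sign changes: for every real-valued $y\in W_2^2$ the number of sign changes of $y$ does not exceed the number of sign changes of $Ly$. -/

import Mathlib

open MeasureTheory Set
open scoped ENNReal ComplexConjugate

noncomputable section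

namespace SignReg

/-- Lebesgue measure on `[0, 1]`. -/
abbrev lebesgue01 : Measure ℝ := volume.restrict (Icc (0 : ℝ) 1)

/-- The complex Hilbert space `L₂[0, 1]`. -/
abbrev L2 : Type := Lp ℂ 2 lebesgue01

/-- Functions of a point of `[0, 1]`, extended to `ℝ` by constants. The values outside `[0, 1]`
never matter; this only lets us write integrals over `[0, 1]` as integrals over `ℝ`. -/
abbrev extend (f : C(unitInterval, ℂ)) : ℝ → ℂ := IccExtend zero_le_one f

lemma continuous_extend (f : C(unitInterval, ℂ)) : Continuous (extend f) :=
  f.continuous.Icc_extend'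

lemma memLp_extend (f : C(unitInterval, ℂ)) (r : ℝ≥0∞) : MemLp (extend f) r lebesgue01 := by
  refine MemLp.of_bound (continuous_extend f).aestronglyMeasurable ‖f‖ (ae_of_all _ fun x => ?_)
  exact f.norm_coe_le_norm _

/-- The embedding of `C[0, 1]` into `L₂[0, 1]`. -/
def contToL2 : C(unitInterval, ℂ) →ₗ[ℂ] L2 where
  toFun f := (memLp_extend f 2).toLp (extend f)
  map_add' f g := by
    exact MemLp.toLp_add (memLp_extend f 2) (memLp_extend g 2)
  map_smul' _ _ := rfl

lemma coeFn_contToL2 (f : C(unitInterval, ℂ)) : contToL2 f =ᵐ[lebesgue01] extend f :=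
  (memLp_extend f 2).coeFn_toLp

lemma contToL2_injective : Function.Injective contToL2 := by
  intro f g hfg
  have h : extend f =ᵐ[lebesgue01] extend g := by
    have h1 := coeFn_contToL2 f
    rw [hfg] at h1
    exact h1.symm.trans (coeFn_contToL2 g)
  have h2 := Measure.eqOn_Icc_of_ae_eq (μ := volume) (zero_ne_one (α := ℝ)) h
    (continuous_extend f).continuousOn (continuous_extend g).continuousOn
  ext x
  have h3 := h2 x.2
  simpa [extend, IccExtend_of_mem zero_le_one _ x.2] using h3

lemma integrableOn_L2 (g : L2) : IntegrableOn g (Icc (0 : ℝ) 1) :=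
  (Lp.memLp g).integrable one_le_two

lemma intervalIntegrable_L2 (g : L2) {a b : ℝ} (ha : a ∈ Icc (0 : ℝ) 1) (hb : b ∈ Icc (0 : ℝ) 1) :
    IntervalIntegrable g volume a b := by
  rw [intervalIntegrable_iff]
  refine (integrableOn_L2 g).mono_set (fun x hx => ?_)
  have := uIoc_subset_uIcc hx
  exact uIcc_subset_Icc ha hb this

lemma zero_mem01 : (0 : ℝ) ∈ Icc (0 : ℝ) 1 := ⟨le_refl _, zero_le_one⟩

/-! ### The Sobolev spaces -/

/-- Pairs `(y, y')` with `y` absolutely continuous on `[0, 1]` and `y' ∈ L₂[0, 1]` its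
derivative. -/
def W21Sub : Submodule ℂ (C(unitInterval, ℂ) × L2) where
  carrier := {u | ∀ x : unitInterval, u.1 x = u.1 0 + ∫ t in (0 : ℝ)..x, u.2 t}
  zero_mem' := fun x => by
    have h : ∫ t in (0 : ℝ)..x, (0 : L2) t = ∫ t in (0 : ℝ)..x, (0 : ℂ) := by
      refine intervalIntegral.integral_congr_ae ?_
      have := (ae_restrict_iff' measurableSet_Icc).1 (Lp.coeFn_zero ℂ 2 lebesgue01)
      filter_upwards [this] with t ht htx
      exact ht (uIcc_subset_Icc zero_mem01 x.2 (uIoc_subset_uIcc htx))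
    rw [Prod.snd_zero, h]
    simp
  add_mem' := fun {u v} hu hv x => by
    have h : ∫ t in (0 : ℝ)..x, (u.2 + v.2 : L2) t = ∫ t in (0 : ℝ)..x, (u.2 t + v.2 t) := by
      refine intervalIntegral.integral_congr_ae ?_
      have := (ae_restrict_iff' measurableSet_Icc).1 (Lp.coeFn_add u.2 v.2)
      filter_upwards [this] with t ht htx
      exact ht (uIcc_subset_Icc zero_mem01 x.2 (uIoc_subset_uIcc htx))
    have h2 := intervalIntegral.integral_add (intervalIntegrable_L2 u.2 zero_mem01 x.2)
      (intervalIntegrable_L2 v.2 zero_mem01 x.2)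
    simp only [Prod.fst_add, Prod.snd_add, ContinuousMap.add_apply]
    rw [h, h2, hu x, hv x]
    ring
  smul_mem' := fun c u hu x => by
    have h : ∫ t in (0 : ℝ)..x, (c • u.2 : L2) t = ∫ t in (0 : ℝ)..x, c • u.2 t := by
      refine intervalIntegral.integral_congr_ae ?_
      have := (ae_restrict_iff' measurableSet_Icc).1 (Lp.coeFn_smul c u.2)
      filter_upwards [this] with t ht htx
      exact ht (uIcc_subset_Icc zero_mem01 x.2 (uIoc_subset_uIcc htx))
    simp only [Prod.smul_fst, Prod.smul_snd, ContinuousMap.smul_apply]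
    rw [h, intervalIntegral.integral_smul, hu x, smul_add]

/-- The complex Sobolev space `W₂¹[0, 1]`: absolutely continuous functions on `[0, 1]` whose
derivative lies in `L₂[0, 1]`. -/
def W21 : Type := W21Sub

namespace W21

instance : AddCommGroup W21 := inferInstanceAs (AddCommGroup W21Sub)

instance : Module ℂ W21 := inferInstanceAs (Module ℂ W21Sub)

/-- The function `u` itself, as a continuous function. -/
def val : W21 →ₗ[ℂ] C(unitInterval, ℂ) := LinearMap.fst ℂ _ _ ∘ₗ W21Sub.subtype

/-- The derivative `u' ∈ L₂[0, 1]`. -/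
def deriv : W21 →ₗ[ℂ] L2 := LinearMap.snd ℂ _ _ ∘ₗ W21Sub.subtype

lemma val_eq (u : W21) (x : unitInterval) :
    u.val x = u.val 0 + ∫ t in (0 : ℝ)..x, u.deriv t := u.2 x

/-- `u ↦ (u, u') ∈ L₂ ⊕ L₂`. -/
def toProd : W21 →ₗ[ℂ] WithLp 2 (L2 × L2) :=
  (WithLp.linearEquiv 2 ℂ (L2 × L2)).symm.toLinearMap ∘ₗ (contToL2 ∘ₗ val).prod deriv

lemma toProd_injective : Function.Injective toProd := by
  intro u v h
  have h1 : (contToL2 (val u), deriv u) = (contToL2 (val v), deriv v) :=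
    (WithLp.linearEquiv 2 ℂ (L2 × L2)).symm.injective h
  have h2 : contToL2 (val u) = contToL2 (val v) := congrArg Prod.fst h1
  have h3 : deriv u = deriv v := (Prod.mk.inj h1).2
  exact Subtype.ext (Prod.ext (contToL2_injective h2) h3)

/-- The Sobolev norm, `‖u‖² = ‖u‖²_{L₂} + ‖u'‖²_{L₂}`. -/
instance : NormedAddCommGroup W21 :=
  NormedAddCommGroup.induced W21 (WithLp 2 (L2 × L2)) toProd toProd_injective

instance : NormedSpace ℂ W21 := NormedSpace.induced ℂ W21 (WithLp 2 (L2 × L2)) toProd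

lemma norm_sq (u : W21) : ‖u‖ ^ 2 = ‖contToL2 u.val‖ ^ 2 + ‖u.deriv‖ ^ 2 :=
  WithLp.prod_norm_sq_eq_of_L2 (toProd u)

/-- A member of `W₂¹[0, 1]` is real if it takes real values. -/
def IsReal (u : W21) : Prop := ∀ x : unitInterval, (u.val x).im = 0

end W21

/-- Pairs `(y, y')` with `y' ∈ W₂¹[0, 1]` and `y` a primitive of `y'`. -/
def W22Sub : Submodule ℂ (C(unitInterval, ℂ) × W21) where
  carrier := {u | ∀ x : unitInterval, u.1 x = u.1 0 + ∫ t in (0 : ℝ)..x, extend u.2.val t}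
  zero_mem' := fun x => by simp [extend, IccExtend]
  add_mem' := fun {u v} hu hv x => by
    have h2 := intervalIntegral.integral_add (μ := volume)
      ((continuous_extend u.2.val).intervalIntegrable 0 x)
      ((continuous_extend v.2.val).intervalIntegrable 0 x)
    have h : ∀ t, extend (u.2 + v.2).val t = extend u.2.val t + extend v.2.val t := by
      intro t; simp [extend, IccExtend]
    simp only [Prod.fst_add, Prod.snd_add, ContinuousMap.add_apply, h]
    rw [h2, hu x, hv x]
    ring
  smul_mem' := fun c u hu x => by
    have h : ∀ t, extend (c • u.2).val t = c • extend u.2.val t := by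
      intro t; simp [extend, IccExtend]
    simp only [Prod.smul_fst, Prod.smul_snd, ContinuousMap.smul_apply, h]
    rw [intervalIntegral.integral_smul, hu x, smul_add]

/-- The complex Sobolev space `W₂²[0, 1]`: continuously differentiable functions on `[0, 1]` whose
derivative is absolutely continuous with derivative in `L₂[0, 1]`. -/
def W22 : Type := W22Sub

namespace W22

instance : AddCommGroup W22 := inferInstanceAs (AddCommGroup W22Sub)

instance : Module ℂ W22 := inferInstanceAs (Module ℂ W22Sub)

/-- The function `y` itself, as a continuous function. -/
def val : W22 →ₗ[ℂ] C(unitInterval, ℂ) := LinearMap.fst ℂ _ _ ∘ₗ W22Sub.subtype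

/-- The derivative `y' ∈ W₂¹[0, 1]`. -/
def deriv : W22 →ₗ[ℂ] W21 := LinearMap.snd ℂ _ _ ∘ₗ W22Sub.subtype

/-- The second derivative `y'' ∈ L₂[0, 1]`. -/
def deriv2 : W22 →ₗ[ℂ] L2 := W21.deriv ∘ₗ deriv

lemma val_eq (y : W22) (x : unitInterval) :
    y.val x = y.val 0 + ∫ t in (0 : ℝ)..x, extend y.deriv.val t := y.2 x

/-- `y ↦ (y, y') ∈ L₂ ⊕ W₂¹`. -/
def toProd : W22 →ₗ[ℂ] WithLp 2 (L2 × W21) :=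
  (WithLp.linearEquiv 2 ℂ (L2 × W21)).symm.toLinearMap ∘ₗ (contToL2 ∘ₗ val).prod deriv

lemma toProd_injective : Function.Injective toProd := by
  intro u v h
  have h1 : (contToL2 (val u), deriv u) = (contToL2 (val v), deriv v) :=
    (WithLp.linearEquiv 2 ℂ (L2 × W21)).symm.injective h
  have h2 : contToL2 (val u) = contToL2 (val v) := congrArg Prod.fst h1
  have h3 : deriv u = deriv v := (Prod.mk.inj h1).2
  exact Subtype.ext (Prod.ext (contToL2_injective h2) h3)

/-- The Sobolev norm, `‖y‖² = ‖y‖²_{L₂} + ‖y'‖²_{L₂} + ‖y''‖²_{L₂}`. -/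
instance : NormedAddCommGroup W22 :=
  NormedAddCommGroup.induced W22 (WithLp 2 (L2 × W21)) toProd toProd_injective

instance : NormedSpace ℂ W22 := NormedSpace.induced ℂ W22 (WithLp 2 (L2 × W21)) toProd

lemma norm_sq (y : W22) :
    ‖y‖ ^ 2 = ‖contToL2 y.val‖ ^ 2 + ‖contToL2 y.deriv.val‖ ^ 2 + ‖y.deriv2‖ ^ 2 := by
  have h := WithLp.prod_norm_sq_eq_of_L2 (toProd y)
  have h2 := W21.norm_sq y.deriv
  have h3 : ‖y‖ ^ 2 = ‖contToL2 y.val‖ ^ 2 + ‖y.deriv‖ ^ 2 := h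
  rw [h3, h2, add_assoc]
  rfl

/-- A member of `W₂²[0, 1]` is real if it takes real values. -/
def IsReal (y : W22) : Prop := ∀ x : unitInterval, (y.val x).im = 0

/-- The embedding `W₂²[0, 1] → L₂[0, 1]`. -/
def toL2 : W22 →L[ℂ] L2 :=
  LinearMap.mkContinuous (contToL2 ∘ₗ val) 1 (fun y => by
    rw [one_mul]
    refine le_of_sq_le_sq ?_ (norm_nonneg y)
    rw [norm_sq y]
    simp only [LinearMap.comp_apply]
    nlinarith [sq_nonneg ‖contToL2 y.deriv.val‖, sq_nonneg ‖y.deriv2‖])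

end W22

/-! ### Products of functions from `W₂¹[0, 1]` -/

lemma ac_ofReal {f : ℝ → ℝ} {a b : ℝ} (hf : AbsolutelyContinuousOnInterval f a b) :
    AbsolutelyContinuousOnInterval (fun x => (f x : ℂ)) a b := by
  rw [absolutelyContinuousOnInterval_iff] at hf ⊢
  simpa only [Complex.isometry_ofReal.dist_eq] using hf

lemma ac_primitive {f : ℝ → ℂ} {a b : ℝ} (hf : IntervalIntegrable f volume a b) :
    AbsolutelyContinuousOnInterval (fun x => ∫ t in a..x, f t) a b := by
  have hre : IntervalIntegrable (fun t => (f t).re) volume a b := ⟨hf.1.re, hf.2.re⟩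
  have him : IntervalIntegrable (fun t => (f t).im) volume a b := ⟨hf.1.im, hf.2.im⟩
  have h1 := ac_ofReal (hre.absolutelyContinuousOnInterval_intervalIntegral left_mem_uIcc)
  have h2 := ac_ofReal (him.absolutelyContinuousOnInterval_intervalIntegral left_mem_uIcc)
  have h3 := h1.add (h2.const_smul Complex.I)
  rw [absolutelyContinuousOnInterval_iff] at h3 ⊢
  intro ε hε
  obtain ⟨δ, hδ, h⟩ := h3 ε hε
  refine ⟨δ, hδ, fun E hE hlt => ?_⟩
  refine lt_of_eq_of_lt (Finset.sum_congr rfl (fun i hi => ?_)) (h E hE hlt)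
  have key : ∀ x ∈ uIcc a b, ∫ t in a..x, f t =
      ((∫ t in a..x, (f t).re : ℝ) : ℂ) + Complex.I • ((∫ t in a..x, (f t).im : ℝ) : ℂ) := by
    intro x hx
    have hs : uIcc a x ⊆ uIcc a b := uIcc_subset_uIcc left_mem_uIcc hx
    have hr := hre.mono_set hs
    have hi := him.mono_set hs
    rw [← intervalIntegral.integral_ofReal, ← intervalIntegral.integral_ofReal,
      ← intervalIntegral.integral_smul, ← intervalIntegral.integral_add]
    · refine intervalIntegral.integral_congr (fun t _ => ?_)
      simp only [smul_eq_mul]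
      rw [mul_comm]
      exact (Complex.re_add_im (f t)).symm
    · exact ⟨hr.1.ofReal, hr.2.ofReal⟩
    · have hi' : IntervalIntegrable (fun t => ((f t).im : ℂ)) volume a x :=
        ⟨hi.1.ofReal, hi.2.ofReal⟩
      exact hi'.smul Complex.I
  have hmem := hE.1 i hi
  simp only [Pi.add_apply]
  rw [key _ hmem.1, key _ hmem.2]

/-- The product rule in integral form. -/
lemma mul_eq_add_integral {f g F G : ℝ → ℂ} {a b : ℝ} (hf : IntervalIntegrable f volume a b)
    (hg : IntervalIntegrable g volume a b)
    (hF : ∀ x ∈ uIcc a b, F x = F a + ∫ t in a..x, f t)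
    (hG : ∀ x ∈ uIcc a b, G x = G a + ∫ t in a..x, g t)
    (hfG : IntervalIntegrable (fun t => f t * G t + F t * g t) volume a b) :
    F b * G b = F a * G a + ∫ t in a..b, (f t * G t + F t * g t) := by
  set F1 : ℝ → ℂ := fun x => F a + ∫ t in a..x, f t with hF1
  set G1 : ℝ → ℂ := fun x => G a + ∫ t in a..x, g t with hG1
  have hconst : ∀ c : ℂ, AbsolutelyContinuousOnInterval (fun _ : ℝ => c) a b := fun c =>
    (contDiff_const.contDiffOn).absolutelyContinuousOnInterval
  have acF : AbsolutelyContinuousOnInterval F1 a b := (hconst (F a)).add (ac_primitive hf)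
  have acG : AbsolutelyContinuousOnInterval G1 a b := (hconst (G a)).add (ac_primitive hg)
  have acH := (acF.smul acG).sub (ac_primitive hfG)
  obtain ⟨C, hC⟩ := acH.const_of_ae_hasDerivAt_zero (by
    filter_upwards [hf.ae_hasDerivAt_integral, hg.ae_hasDerivAt_integral,
      hfG.ae_hasDerivAt_integral] with x h1 h2 h3 hx
    have d1 := (h1 hx a left_mem_uIcc).const_add (F a)
    have d2 := (h2 hx a left_mem_uIcc).const_add (G a)
    have d3 := h3 hx a left_mem_uIcc
    have d4 := (d1.mul d2).sub d3
    have e : f x * (G a + ∫ t in a..x, g t) + (F a + ∫ t in a..x, f t) * g x -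
        (f x * G x + F x * g x) = 0 := by
      rw [← hF x hx, ← hG x hx, sub_self]
    rw [e] at d4
    exact d4)
  have ha := hC a left_mem_uIcc
  have hb := hC b right_mem_uIcc
  simp only [Pi.sub_apply, smul_eq_mul, Pi.mul_apply, hF1, hG1,
    intervalIntegral.integral_same, add_zero, sub_zero] at ha hb
  rw [← hF b right_mem_uIcc, ← hG b right_mem_uIcc] at hb
  rw [ha, ← hb]
  ring

lemma extend_coe (f : C(unitInterval, ℂ)) (x : unitInterval) : extend f x = f x := by
  simp [extend]

lemma memLp_starMul (u v : W21) :
    MemLp (fun t => conj (u.deriv t) * extend v.val t + conj (extend u.val t) * v.deriv t) 2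
      lebesgue01 := by
  have hu := (Lp.memLp u.deriv).star
  have hv := Lp.memLp v.deriv
  have h1 := (memLp_extend v.val ∞).mul hu (r := 2)
  have h2 := hv.mul (memLp_extend u.val ∞).star (r := 2)
  exact h1.add h2

/-- The product `ū v` of two functions from `W₂¹[0, 1]`, again a member of `W₂¹[0, 1]`, with
derivative `ū' v + ū v'`. -/
def W21.starMul (u v : W21) : W21 :=
  ⟨(star u.val * v.val, (memLp_starMul u v).toLp _), fun x => by
    have hx : uIcc (0 : ℝ) x ⊆ Icc (0 : ℝ) 1 := uIcc_subset_Icc zero_mem01 x.2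
    have hu := intervalIntegrable_L2 u.deriv zero_mem01 x.2
    have hv := intervalIntegrable_L2 v.deriv zero_mem01 x.2
    have hi : IntervalIntegrable (fun t => conj (u.deriv t) * extend v.val t +
        conj (extend u.val t) * v.deriv t) volume 0 x := by
      rw [intervalIntegrable_iff]
      exact IntegrableOn.mono_set ((memLp_starMul u v).integrable one_le_two)
        (uIoc_subset_uIcc.trans hx)
    have hu' : IntervalIntegrable (fun t => conj (u.deriv t)) volume 0 x := by
      rw [intervalIntegrable_iff] at hu ⊢
      exact (Complex.conjLIE.toContinuousLinearEquiv.integrable_comp_iff).2 hu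
    have h0 : extend u.val 0 = u.val 0 := extend_coe u.val 0
    have h0' : extend v.val 0 = v.val 0 := extend_coe v.val 0
    have key := mul_eq_add_integral (F := fun t => conj (extend u.val t)) (G := extend v.val)
      hu' hv
      (fun t ht => by
        have ht0 : (0 : ℝ) ≤ t := (hx ht).1
        have h1 := u.val_eq ⟨t, hx ht⟩
        have h2 := extend_coe u.val ⟨t, hx ht⟩
        simp only at h1 h2
        rw [h2, h1, h0, map_add, intervalIntegral.integral_of_le ht0,
          intervalIntegral.integral_of_le ht0, integral_conj])
      (fun t ht => by
        have h1 := v.val_eq ⟨t, hx ht⟩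
        have h2 := extend_coe v.val ⟨t, hx ht⟩
        simp only at h1 h2
        rw [h2, h1, h0'])
      hi
    have h : ∫ t in (0 : ℝ)..x, ((memLp_starMul u v).toLp _ : L2) t = ∫ t in (0 : ℝ)..x,
        (conj (u.deriv t) * extend v.val t + conj (extend u.val t) * v.deriv t) := by
      refine intervalIntegral.integral_congr_ae ?_
      have := (ae_restrict_iff' measurableSet_Icc).1 (memLp_starMul u v).coeFn_toLp
      filter_upwards [this] with t ht htx
      exact ht (hx (uIoc_subset_uIcc htx))
    simp only [ContinuousMap.mul_apply, ContinuousMap.star_apply]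
    rw [h]
    simp only [extend_coe, h0, h0'] at key
    exact key⟩

lemma W21.starMul_val (u v : W21) (x : unitInterval) :
    (u.starMul v).val x = conj (u.val x) * v.val x := rfl

/-! ### Dual spaces and sign changes -/

/-- `W₂⁻¹[0, 1]`: the bounded antilinear functionals on `W₂¹[0, 1]`. -/
abbrev W21Dual : Type := W21 →L⋆[ℂ] ℂ

/-- `W₂⁻²[0, 1]`: the bounded antilinear functionals on `W₂²[0, 1]`. -/
abbrev W22Dual : Type := W22 →L⋆[ℂ] ℂ

/-- A member of `W₂⁻¹[0, 1]` is real if it takes real values at real functions. -/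
def IsRealDistribution (q : W21Dual) : Prop := ∀ u : W21, u.IsReal → (q u).im = 0

/-- A function on `[0, 1]` has at most `n` sign changes if there are no
`ξ₀ < ξ₁ < ⋯ < ξₙ₊₁` at which its values strictly alternate in sign. -/
def AtMostSignChanges (n : ℕ) (f : unitInterval → ℝ) : Prop :=
  ¬ ∃ ξ : Fin (n + 2) → unitInterval, StrictMono ξ ∧
    ∀ k : Fin (n + 1), f (ξ k.castSucc) * f (ξ k.succ) < 0

/-- A real continuous function `f` as the member `z ↦ ∫ f z̄` of `W₂⁻²[0, 1]`. -/
def ofContinuous (f : C(unitInterval, ℝ)) : W22Dual :=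
  (innerSLFlip ℂ (contToL2 ((⟨Complex.ofReal, Complex.continuous_ofReal⟩ : C(ℝ, ℂ)).comp f))).comp
    W22.toL2

lemma ofContinuous_apply (f : C(unitInterval, ℝ)) (z : W22) :
    ofContinuous f z =
      ∫ x in (0 : ℝ)..1, ((IccExtend zero_le_one (f : unitInterval → ℝ) x : ℝ) : ℂ) * conj (extend z.val x) := by
  have h : ofContinuous f z = inner ℂ (contToL2 z.val)
      (contToL2 ((⟨Complex.ofReal, Complex.continuous_ofReal⟩ : C(ℝ, ℂ)).comp f)) := rfl
  rw [h, L2.inner_def, intervalIntegral.integral_of_le zero_le_one, ← integral_Icc_eq_integral_Ioc]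
  refine integral_congr_ae ?_
  filter_upwards [coeFn_contToL2 z.val,
    coeFn_contToL2 ((⟨Complex.ofReal, Complex.continuous_ofReal⟩ : C(ℝ, ℂ)).comp f)] with t h1 h2
  rw [h1, h2]
  rfl

/-- A member of `W₂⁻²[0, 1]` has at most `n` sign changes if it can be approximated arbitrarily
well, in the norm of `W₂⁻²[0, 1]`, by real continuous functions with at most `n` sign changes. -/
def AtMostSignChangesDual (n : ℕ) (F : W22Dual) : Prop :=
  F ∈ closure {G | ∃ f : C(unitInterval, ℝ), AtMostSignChanges n f ∧ ofContinuous f = G}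

/-- The number of sign changes of a function, possibly infinite. -/
def signChanges (f : unitInterval → ℝ) : ℕ∞ := ⨅ (n : ℕ) (_ : AtMostSignChanges n f), (n : ℕ∞)

/-- The number of sign changes of a member of `W₂⁻²[0, 1]`, possibly infinite. -/
def signChangesDual (F : W22Dual) : ℕ∞ := ⨅ (n : ℕ) (_ : AtMostSignChangesDual n F), (n : ℕ∞)

/-- The operator `L` does not decrease the number of sign changes: no real `y` has more sign
changes than `L y`. -/
def DoesNotDecreaseSignChanges (L : W22 →L[ℂ] W22Dual) : Prop :=
  ∀ y : W22, y.IsReal → signChanges (fun x => (y.val x).re) ≤ signChangesDual (L y)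

end SignReg

end

noncomputable section

namespace SignReg

/-! ### Alternating sequences -/

/-! Suppose that `y` alternates at `n + 2` points, starting with the sign `s`. It suffices to show
that every continuous `f` close to `Ly` in `W₂⁻²` alternates at `n + 2` points too, since then `Ly`
is no limit of functions with at most `n` sign changes.

The link is between `y'` and the tail integral `g(x) = ∫ₓ¹ f`. Cut `y'` off to a nodal interval and
let `z` be the primitive of the cut-off with `z(0) = 0`. The term with `α` then vanishes, and `z'`,
`z''` coincide with `y'`, `y''` on the interval and vanish off it, so `⟨Ly, z⟩ = ⟨Lz, z⟩ > 0`. This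
survives for `f` near `Ly`, and by parts `⟨f, z⟩ = ∫ z' g`; so `g` takes the sign of `y'` somewhere
in each nodal interval. Finitely many intervals are needed, hence one neighbourhood of `Ly`
suffices.

It remains to count. Passing from `y` to `y'` may lose one alternation, by Rolle. If `s y(0) ≤ 0`,
the increment of `y` from `0` to the first point makes up for it. If `s y(0) > 0`, the test function
`1` does: `⟨Ly, 1⟩ = α y(0)`, so `g(0) = ⟨f, 1⟩` has the sign `s`, and `0` joins the points of
alternation of `g`. Passing from `g` to `f = -g'` loses nothing, because `g(1) = 0`. -/

/-- The function `f` takes values of the signs of `s, -s, s, …` at some `m + 1` points, from left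
to right. -/
def Alternates (m : ℕ) (s : ℝ) (f : unitInterval → ℝ) : Prop :=
  ∃ ξ : ℕ → unitInterval, (∀ k < m, ξ k < ξ (k + 1)) ∧ ∀ k ≤ m, 0 < s * (-1) ^ k * f (ξ k)

lemma exists_alternates_of_not_atMostSignChanges {n : ℕ} {f : unitInterval → ℝ}
    (h : ¬ AtMostSignChanges n f) : ∃ s, Alternates (n + 1) s f := by
  obtain ⟨ξ, hmono, halt⟩ := not_not.1 h
  -- Only the sign of `s` matters, so the first value of `f` serves. `Fin.ofNat` wraps around beyond
  -- `n + 1`, where nothing is required.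
  refine ⟨f (ξ 0), fun k => ξ (Fin.ofNat (n + 2) k), fun k hk => hmono ?_, fun k => ?_⟩
  · simp only [Fin.lt_def, Fin.val_ofNat]
    rw [Nat.mod_eq_of_lt (by omega), Nat.mod_eq_of_lt (by omega)]
    omega
  · induction k with
    | zero =>
      intro _
      have h0 := halt 0
      have hne : f (ξ 0) ≠ 0 := fun h0' => by
        have e : ξ (Fin.castSucc (0 : Fin (n + 1))) = ξ 0 := rfl
        rw [e, h0', zero_mul] at h0
        exact lt_irrefl _ h0
      simpa using mul_self_pos.2 hne
    | succ k ih =>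
      intro hk
      have h1 := ih (by omega)
      have h2 := halt ⟨k, by omega⟩
      have e1 : (Fin.castSucc (⟨k, by omega⟩ : Fin (n + 1))) = Fin.ofNat (n + 2) k :=
        Fin.ext (by simp [Nat.mod_eq_of_lt (show k < n + 2 by omega)])
      have e2 : (Fin.succ (⟨k, by omega⟩ : Fin (n + 1))) = Fin.ofNat (n + 2) (k + 1) :=
        Fin.ext (by simp [Nat.mod_eq_of_lt (show k + 1 < n + 2 by omega)])
      rw [e1, e2] at h2
      rw [pow_succ]
      by_contra! h3
      have h4 : 0 ≤ f (ξ 0) * (-1) ^ k * f (ξ (Fin.ofNat (n + 2) (k + 1))) := by linarith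
      have h5 := mul_nonneg h1.le h4
      have h6 : (f (ξ 0) * (-1) ^ k) ^ 2 * (f (ξ (Fin.ofNat (n + 2) k)) *
          f (ξ (Fin.ofNat (n + 2) (k + 1)))) < 0 :=
        mul_neg_of_pos_of_neg (by
          have : f (ξ 0) * (-1) ^ k ≠ 0 := left_ne_zero_of_mul h1.ne'
          positivity) h2
      nlinarith

lemma Alternates.not_atMostSignChanges {n : ℕ} {s : ℝ} {f : unitInterval → ℝ}
    (h : Alternates (n + 1) s f) : ¬ AtMostSignChanges n f := by
  obtain ⟨ξ, hmono, halt⟩ := h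
  refine not_not.2 ⟨fun k => ξ k, Fin.strictMono_iff_lt_succ.2 fun k => ?_, fun k => ?_⟩
  · exact hmono k k.2
  · have h1 := halt k (by omega)
    have h2 := halt (k + 1) (by omega)
    simp only [Fin.val_castSucc, Fin.val_succ]
    have h3 := mul_pos h1 h2
    have h4 : (s * (-1) ^ (k : ℕ)) ^ 2 * (f (ξ k) * f (ξ (k + 1))) < 0 := by
      rw [pow_succ (-1 : ℝ)] at h3
      nlinarith
    by_contra! h5
    exact absurd h4 (not_lt.2 (mul_nonneg (sq_nonneg _) h5))

/-- The old first point cannot be `0`, since `f` has there the sign opposite to that of `f 0`. This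
restores the alternation lost to Rolle when `y` starts with the sign `s`. -/
lemma Alternates.cons {m : ℕ} {s : ℝ} {f : unitInterval → ℝ} (h : Alternates m (-s) f)
    (h0 : 0 < s * f 0) : Alternates (m + 1) s f := by
  obtain ⟨ξ, hmono, halt⟩ := h
  refine ⟨fun k => Nat.casesOn k 0 ξ, fun k hk => ?_, fun k hk => ?_⟩
  · cases k with
    | zero =>
      refine lt_of_le_of_ne unitInterval.nonneg' fun e => ?_
      have e' : ξ 0 = 0 := e.symm
      have := halt 0 (Nat.zero_le _)
      rw [e'] at this
      simp only [pow_zero, mul_one] at this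
      linarith
    | succ k => exact hmono k (by omega)
  · cases k with
    | zero => simpa using h0
    | succ k =>
      have := halt k (by omega)
      simpa [pow_succ] using this

/-- A function with an alternating sequence of weighted integrals over successive intervals
alternates. -/
lemma alternates_of_integral {m : ℕ} {s : ℝ} {f : unitInterval → ℝ} (w : ℕ → ℝ → ℝ)
    (c d : ℕ → ℝ) (hc : ∀ k ≤ m, 0 ≤ c k) (hd : ∀ k ≤ m, d k ≤ 1) (hcd : ∀ k ≤ m, c k ≤ d k)
    (hdc : ∀ k < m, d k ≤ c (k + 1)) (hw : ∀ k ≤ m, ∀ x ∈ Ioo (c k) (d k), 0 ≤ w k x)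
    (hint : ∀ k ≤ m, 0 < ∫ x in c k..d k, w k x * (s * (-1) ^ k * IccExtend zero_le_one f x)) :
    Alternates m s f := by
  -- If the required sign never occurred, the integrand would be nonpositive. Points of open
  -- intervals stay distinct even when neighbouring intervals share an endpoint.
  have key : ∀ k ≤ m, ∃ x : unitInterval, (x : ℝ) ∈ Ioo (c k) (d k) ∧
      0 < s * (-1) ^ k * f x := by
    intro k hk
    by_contra! hcon
    refine absurd (hint k hk) (not_lt.2 ?_)
    rw [intervalIntegral.integral_of_le (hcd k hk), integral_Ioc_eq_integral_Ioo]
    refine setIntegral_nonpos measurableSet_Ioo fun x hx => ?_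
    have hx' : x ∈ Icc (0 : ℝ) 1 :=
      ⟨(hc k hk).trans hx.1.le, hx.2.le.trans (hd k hk)⟩
    refine mul_nonpos_of_nonneg_of_nonpos (hw k hk x hx) ?_
    rw [IccExtend_of_mem _ _ hx']
    exact hcon ⟨x, hx'⟩ hx
  choose! ξ h1 h2 using key
  refine ⟨ξ, fun k hk => ?_, h2⟩
  have := (h1 k hk.le).2
  have := (h1 (k + 1) hk).1
  have := hdc k hk
  exact Subtype.coe_lt_coe.1 (by linarith)

lemma alternates_of_integral_succ {m : ℕ} {s : ℝ} {f : unitInterval → ℝ} (a : ℕ → unitInterval)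
    (ha : ∀ k ≤ m, a k ≤ a (k + 1))
    (hint : ∀ k ≤ m, 0 < s * (-1) ^ k * ∫ x in (a k : ℝ)..a (k + 1), IccExtend zero_le_one f x) :
    Alternates m s f := by
  refine alternates_of_integral (fun _ _ => 1) (fun k => a k) (fun k => a (k + 1))
    (fun k _ => (a k).2.1) (fun k _ => (a (k + 1)).2.2) (fun k hk => ha k hk) (fun _ _ => le_rfl)
    (fun _ _ _ _ => zero_le_one) fun k hk => ?_
  simpa only [one_mul, intervalIntegral.integral_const_mul] using hint k hk

/-- If a primitive of `u` alternates, so does `u`, between the points given. -/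
lemma Alternates.of_primitive {m : ℕ} {s : ℝ} {y : unitInterval → ℝ} {u : C(unitInterval, ℝ)}
    (hy : ∀ x, y x = y 0 + ∫ t in (0 : ℝ)..x, IccExtend zero_le_one u t)
    (h : Alternates (m + 1) s y) : Alternates m (-s) u := by
  obtain ⟨ξ, hmono, halt⟩ := h
  have hu : Continuous (IccExtend (zero_le_one (α := ℝ)) u) := u.continuous.Icc_extend'
  refine alternates_of_integral_succ ξ (fun k hk => (hmono k (by omega)).le) fun k hk => ?_
  have h1 := halt k (by omega)
  have h2 := halt (k + 1) (by omega)
  rw [← intervalIntegral.integral_interval_sub_left (hu.intervalIntegrable 0 _)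
    (hu.intervalIntegrable 0 _)]
  rw [hy] at h1 h2
  rw [pow_succ] at h2
  linarith

/-- If a primitive of `u` alternates and starts from `0` with the wrong sign, then `u` alternates
as many times. -/
lemma Alternates.of_primitive_of_nonpos {m : ℕ} {s : ℝ} {y : unitInterval → ℝ}
    {u : C(unitInterval, ℝ)}
    (hy : ∀ x, y x = y 0 + ∫ t in (0 : ℝ)..x, IccExtend zero_le_one u t)
    (h : Alternates m s y) (h0 : s * y 0 ≤ 0) : Alternates m s u := by
  obtain ⟨ξ, hmono, halt⟩ := h
  have hu : Continuous (IccExtend (zero_le_one (α := ℝ)) u) := u.continuous.Icc_extend'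
  refine alternates_of_integral_succ (fun k => Nat.casesOn k 0 ξ) (fun k hk => ?_) fun k hk => ?_
  · cases k with
    | zero => exact unitInterval.nonneg'
    | succ k => exact (hmono k (by omega)).le
  · cases k with
    | zero =>
      have h1 := halt 0 (Nat.zero_le _)
      rw [hy] at h1
      simp only [pow_zero, mul_one] at h1 ⊢
      change 0 < s * ∫ x in (0 : ℝ)..ξ 0, IccExtend zero_le_one u x
      linarith
    | succ k =>
      have h1 := halt k (by omega)
      have h2 := halt (k + 1) (by omega)
      simp only
      rw [← intervalIntegral.integral_interval_sub_left (hu.intervalIntegrable 0 _)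
        (hu.intervalIntegrable 0 _)]
      rw [hy] at h1 h2
      rw [pow_succ] at h2 ⊢
      linarith

/-- If `x ↦ ∫ₓ¹ f` alternates, so does `f`, as many times. -/
lemma Alternates.of_tail_integral {m : ℕ} {s : ℝ} {f : C(unitInterval, ℝ)}
    (h : Alternates m s fun x => ∫ t in (x : ℝ)..1, IccExtend zero_le_one f t) :
    Alternates m s f := by
  obtain ⟨ξ, hmono, halt⟩ := h
  have hf : Continuous (IccExtend (zero_le_one (α := ℝ)) f) := f.continuous.Icc_extend'
  -- The point `1` is appended: the tail integral vanishes there, so the last increment is its value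
  -- at `ξ m`.
  refine alternates_of_integral_succ (fun k => if k ≤ m then ξ k else 1) (fun k hk => ?_)
    fun k hk => ?_
  · rcases hk.lt_or_eq with hk' | rfl
    · simpa [hk, Nat.succ_le_iff.2 hk'] using (hmono k hk').le
    · simpa using unitInterval.le_one'
  · have h1 := halt k hk
    rcases hk.lt_or_eq with hk' | rfl
    · have h2 := halt (k + 1) hk'
      beta_reduce at h1 h2
      simp only [hk, Nat.succ_le_iff.2 hk', if_true]
      rw [← intervalIntegral.integral_add_adjacent_intervals
        (hf.intervalIntegrable (ξ k) (ξ (k + 1))) (hf.intervalIntegrable _ 1)] at h1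
      rw [pow_succ] at h2
      linarith
    · simpa using h1

/-! ### Nodal intervals -/

/-- The nodal interval of a continuous function around a point. -/
lemma exists_nodal_interval {u : ℝ → ℝ} (hu : Continuous u) {t η : ℝ} (hη : η ∈ Icc (0 : ℝ) 1)
    (ht : 0 < t * u η) :
    ∃ c d, 0 ≤ c ∧ c ≤ η ∧ η ≤ d ∧ d ≤ 1 ∧ c < d ∧ (c = 0 ∨ u c = 0) ∧ (d = 1 ∨ u d = 0) ∧
      ∀ x ∈ Ioo c d, 0 < t * u x := by
  have hz : IsClosed {x | u x = 0} := isClosed_eq hu continuous_const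
  -- The nearest zeros of `u` on either side of `η`, with the endpoints of `[0, 1]` admitted as
  -- substitutes.
  obtain ⟨c, ⟨hcm, hc⟩, hcub⟩ := IsCompact.exists_isGreatest
    (isCompact_Icc.inter_right ((isClosed_singleton (x := (0 : ℝ))).union hz))
    (⟨0, ⟨le_rfl, hη.1⟩, Or.inl rfl⟩ : (Icc 0 η ∩ ({0} ∪ {x | u x = 0})).Nonempty)
  obtain ⟨d, ⟨hdm, hd⟩, hdlb⟩ := IsCompact.exists_isLeast
    (isCompact_Icc.inter_right ((isClosed_singleton (x := (1 : ℝ))).union hz))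
    (⟨1, ⟨hη.2, le_rfl⟩, Or.inl rfl⟩ : (Icc η 1 ∩ ({1} ∪ {x | u x = 0})).Nonempty)
  have hne : u η ≠ 0 := right_ne_zero_of_mul ht.ne'
  refine ⟨c, d, hcm.1, hcm.2, hdm.1, hdm.2, ?_, hc, hd, fun x hx => ?_⟩
  · refine lt_of_le_of_ne (hcm.2.trans hdm.1) ?_
    rintro rfl
    have e : η = c := le_antisymm hdm.1 hcm.2
    subst e
    rcases hc with hc | hc
    · rcases hd with hd | hd
      · simp only [mem_singleton_iff] at hc hd
        linarith
      · exact hne hd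
    · exact hne hc
  · by_contra! hle
    have hcont : Continuous fun x => t * u x := continuous_const.mul hu
    -- A wrong sign at `x` forces a zero between `x` and `η`, against the choice of `c` or `d`.
    obtain ⟨z, hzm, hz0⟩ := intermediate_value_uIcc (a := x) (b := η) hcont.continuousOn
      (mem_uIcc_of_le hle ht.le)
    have hz1 : u z = 0 := by
      rcases mul_eq_zero.1 hz0 with h | h
      · rw [h, zero_mul] at ht
        exact absurd ht (lt_irrefl _)
      · exact h
    rcases le_total x η with h | h
    · rw [uIcc_of_le h] at hzm
      have := hcub ⟨⟨hcm.1.trans (hx.1.le.trans hzm.1), hzm.2⟩, Or.inr hz1⟩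
      linarith [hx.1, hzm.1]
    · rw [uIcc_of_ge h] at hzm
      have := hdlb ⟨⟨hzm.1, hzm.2.trans (hx.2.le.trans hdm.2)⟩, Or.inr hz1⟩
      linarith [hx.2, hzm.2]

/-- The nodal intervals around successive points of an alternating sequence are ordered. -/
lemma Alternates.exists_nodal_intervals {m : ℕ} {s : ℝ} {u : C(unitInterval, ℝ)}
    (h : Alternates m s u) :
    ∃ c d : ℕ → ℝ, (∀ k < m, d k ≤ c (k + 1)) ∧ ∀ k ≤ m, 0 ≤ c k ∧ c k < d k ∧ d k ≤ 1 ∧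
      (c k = 0 ∨ IccExtend zero_le_one u (c k) = 0) ∧
      (d k = 1 ∨ IccExtend zero_le_one u (d k) = 0) ∧
      ∀ x ∈ Ioo (c k) (d k), 0 < s * (-1) ^ k * IccExtend zero_le_one u x := by
  obtain ⟨ξ, hmono, halt⟩ := h
  have hu : Continuous (IccExtend (zero_le_one (α := ℝ)) u) := u.continuous.Icc_extend'
  have key : ∀ k ≤ m, _ := fun k hk => exists_nodal_interval hu (t := s * (-1) ^ k) (ξ k).2
    (by rw [IccExtend_val]; exact halt k hk)
  choose! c d h1 h2 h3 h4 h5 h6 h7 h8 using key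
  refine ⟨c, d, fun k hk => ?_, fun k hk =>
    ⟨h1 k hk, h5 k hk, h4 k hk, h6 k hk, h7 k hk, h8 k hk⟩⟩
  by_contra! hlt
  have hm : (ξ k : ℝ) < ξ (k + 1) := hmono k hk
  have a1 := h2 k hk.le
  have a2 := h3 (k + 1) hk
  have a3 := h5 k hk.le
  have a4 := h5 (k + 1) hk
  -- Were the intervals out of order, they would overlap, and `u` would have both signs at a common
  -- point.
  obtain ⟨x, hx1, hx2⟩ := exists_between
    (show max (c k) (c (k + 1)) < min (d k) (d (k + 1)) from
      max_lt (lt_min a3 (by linarith)) (lt_min hlt a4))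
  have b1 := h8 k hk.le x ⟨(le_max_left _ _).trans_lt hx1, hx2.trans_le (min_le_left _ _)⟩
  have b2 := h8 (k + 1) hk x ⟨(le_max_right _ _).trans_lt hx1, hx2.trans_le (min_le_right _ _)⟩
  rw [pow_succ] at b2
  linarith

/-! ### Construction of members of the Sobolev spaces -/

lemma W21.ext {u v : W21} (h1 : ∀ x, u.val x = v.val x) (h2 : u.deriv =ᵐ[lebesgue01] v.deriv) :
    u = v :=
  Subtype.ext (Prod.ext (ContinuousMap.ext h1) (Lp.ext h2))

lemma W21.starMul_deriv_ae (u v : W21) : (u.starMul v).deriv =ᵐ[lebesgue01]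
    fun t => conj (u.deriv t) * extend v.val t + conj (extend u.val t) * v.deriv t :=
  (memLp_starMul u v).coeFn_toLp

/-- The member of `W₂¹[0, 1]` with a given derivative and a given value at `0`. -/
def W21.primitive (g : L2) (a : ℂ) : W21 :=
  ⟨(⟨fun x => a + ∫ t in (0 : ℝ)..x, g t, by
    have h := intervalIntegral.continuousOn_primitive_interval (μ := volume) (f := g)
      (a := 0) (b := 1) (by rw [uIcc_of_le zero_le_one]; exact integrableOn_L2 g)
    rw [uIcc_of_le zero_le_one] at h
    exact continuous_const.add (continuousOn_iff_continuous_domRestrict.1 h)⟩, g), fun x => by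
    simp⟩

/-- The member of `W₂²[0, 1]` with a given derivative and a given value at `0`. -/
def W22.primitive (v : W21) (a : ℂ) : W22 :=
  ⟨(⟨fun x => a + ∫ t in (0 : ℝ)..x, extend v.val t, by
    have h := intervalIntegral.continuous_primitive (μ := volume)
      (fun b c => (continuous_extend v.val).intervalIntegrable b c) 0
    exact continuous_const.add (h.comp continuous_subtype_val)⟩, v), fun x => by
    simp⟩

lemma W22.primitive_val (v : W21) (a : ℂ) (x : unitInterval) :
    (W22.primitive v a).val x = a + ∫ t in (0 : ℝ)..x, extend v.val t := rfl

lemma W22.primitive_deriv (v : W21) (a : ℂ) : (W22.primitive v a).deriv = v := rfl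

lemma W22.primitive_val_zero (v : W21) (a : ℂ) : (W22.primitive v a).val 0 = a := by
  simp [W22.primitive_val]

/-- Cutting a member of `W₂¹[0, 1]` off outside an interval at whose endpoints, unless they are
endpoints of `[0, 1]`, it vanishes. -/
lemma W21.exists_cutoff (u : W21) {c d : ℝ} (h0 : 0 ≤ c) (hcd : c < d) (h1 : d ≤ 1)
    (hc : c = 0 ∨ extend u.val c = 0) (hd : d = 1 ∨ extend u.val d = 0) :
    ∃ v : W21, (∀ x, extend v.val x =
        (Icc c d).indicator (extend u.val) (projIcc 0 1 zero_le_one x)) ∧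
      v.deriv =ᵐ[lebesgue01] (Icc c d).indicator u.deriv := by
  have hm : MemLp ((Icc c d).indicator u.deriv) 2 lebesgue01 :=
    (Lp.memLp u.deriv).indicator measurableSet_Icc
  have hval : ∀ x : unitInterval, extend u.val x = u.val 0 + ∫ t in (0 : ℝ)..x, u.deriv t :=
    fun x => by rw [extend_coe, u.val_eq]
  have hcI : c ∈ Icc (0 : ℝ) 1 := ⟨h0, hcd.le.trans h1⟩
  have hdI : d ∈ Icc (0 : ℝ) 1 := ⟨h0.trans hcd.le, h1⟩
  have hint : ∀ x : unitInterval, ∫ t in (0 : ℝ)..x, hm.toLp _ t =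
      ∫ t in Ioc (0 : ℝ) x ∩ Icc c d, u.deriv t := by
    intro x
    rw [intervalIntegral.integral_of_le x.2.1, ← setIntegral_indicator measurableSet_Icc]
    refine setIntegral_congr_ae measurableSet_Ioc ?_
    have := (ae_restrict_iff' measurableSet_Icc).1 hm.coeFn_toLp
    filter_upwards [this] with t ht htx
    exact ht ⟨htx.1.le, htx.2.trans x.2.2⟩
  have hsub : ∀ e ∈ Icc (0 : ℝ) 1, c ≤ e →
      ∫ t in Icc c e, u.deriv t = extend u.val e - extend u.val c := by
    intro e he hce
    have hc' := hval ⟨c, hcI⟩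
    have he' := hval ⟨e, he⟩
    simp only at hc' he'
    rw [he', hc', add_sub_add_left_eq_sub, intervalIntegral.integral_interval_sub_left
      (intervalIntegrable_L2 _ zero_mem01 he) (intervalIntegrable_L2 _ zero_mem01 hcI),
      intervalIntegral.integral_of_le hce, integral_Icc_eq_integral_Ioc]
  -- The starting value `u(c)` covers both cases: it is `u(0)` if `c = 0`, and `0` otherwise.
  refine ⟨W21.primitive (hm.toLp _) (extend u.val c), fun x => ?_, hm.coeFn_toLp⟩
  have hmain : ∀ x : unitInterval, extend u.val c + ∫ t in (0 : ℝ)..x, hm.toLp _ t =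
      (Icc c d).indicator (extend u.val) x := by
    intro x
    rw [hint]
    rcases lt_or_ge (x : ℝ) c with hx | hx
    · have hem : Ioc (0 : ℝ) x ∩ Icc c d = ∅ := by
        ext t
        simp only [mem_inter_iff, mem_Ioc, mem_Icc, mem_empty_iff_false, iff_false]
        rintro ⟨⟨_, h2⟩, h3, _⟩
        linarith
      rw [hem, setIntegral_empty, add_zero, indicator_of_notMem (fun h => absurd h.1 (not_le.2 hx))]
      exact hc.resolve_left (x.2.1.trans_lt hx).ne'
    -- The sets may differ at the point `0`, which matters when `c = 0`.
    · have hae : ∀ e : ℝ, e = min (x : ℝ) d →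
          (Ioc (0 : ℝ) x ∩ Icc c d : Set ℝ) =ᵐ[volume] Icc c e := by
        rintro e rfl
        have hn : ∀ᵐ t : ℝ, t ≠ 0 := by
          simp [ae_iff]
        filter_upwards [hn] with t ht
        refine propext ?_
        change (0 < t ∧ t ≤ (x : ℝ)) ∧ c ≤ t ∧ t ≤ d ↔ c ≤ t ∧ t ≤ min (x : ℝ) d
        rw [le_min_iff]
        constructor
        · rintro ⟨⟨_, h2⟩, h3, h4⟩
          exact ⟨h3, h2, h4⟩
        · rintro ⟨h3, h2, h4⟩
          exact ⟨⟨lt_of_le_of_ne (h0.trans h3) ht.symm, h2⟩, h3, h4⟩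
      rcases le_or_gt (x : ℝ) d with hxd | hxd
      · rw [setIntegral_congr_set (hae x (min_eq_left hxd).symm), hsub x x.2 hx,
          indicator_of_mem (show (x : ℝ) ∈ Icc c d from ⟨hx, hxd⟩)]
        ring
      · rw [setIntegral_congr_set (hae d (min_eq_right hxd.le).symm), hsub d hdI hcd.le,
          indicator_of_notMem (fun h => absurd h.2 (not_le.2 hxd)),
          hd.resolve_left (hxd.trans_le x.2.2).ne]
        ring
  exact hmain _

/-! ### Real parts, test functions and products with cut-offs -/

/-- The real part of a complex continuous function. -/
def rePart (f : C(unitInterval, ℂ)) : C(unitInterval, ℝ) :=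
  (⟨Complex.re, Complex.continuous_re⟩ : C(ℂ, ℝ)).comp f

lemma extend_rePart (f : C(unitInterval, ℂ)) (x : ℝ) :
    IccExtend zero_le_one (rePart f) x = (extend f x).re := rfl

lemma re_intervalIntegral {f : ℝ → ℂ} (hf : Continuous f) (a b : ℝ) :
    (∫ t in a..b, f t).re = ∫ t in a..b, (f t).re :=
  (Complex.reCLM.intervalIntegral_comp_comm (hf.intervalIntegrable a b)).symm

lemma im_intervalIntegral {f : ℝ → ℂ} (hf : Continuous f) (a b : ℝ) :
    (∫ t in a..b, f t).im = ∫ t in a..b, (f t).im :=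
  (Complex.imCLM.intervalIntegral_comp_comm (hf.intervalIntegrable a b)).symm

lemma W22.re_val_eq (y : W22) (x : unitInterval) :
    rePart y.val x =
      rePart y.val 0 + ∫ t in (0 : ℝ)..x, IccExtend zero_le_one (rePart y.deriv.val) t := by
  have h := congrArg Complex.re (y.val_eq x)
  rw [Complex.add_re, re_intervalIntegral (continuous_extend _)] at h
  exact h

/-- The derivative of a real function is real. -/
lemma W22.IsReal.deriv {y : W22} (hy : y.IsReal) : y.deriv.IsReal := by
  have hc : Continuous fun t => (extend y.deriv.val t).im :=
    Complex.continuous_im.comp (continuous_extend _)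
  have hzero : ∀ x ∈ Icc (0 : ℝ) 1, ∫ t in (0 : ℝ)..x, (extend y.deriv.val t).im = 0 := by
    intro x hx
    have h := congrArg Complex.im (y.val_eq ⟨x, hx⟩)
    rw [Complex.add_im, im_intervalIntegral (continuous_extend _), hy, hy, zero_add] at h
    exact h.symm
  have hIoo : ∀ x ∈ Ioo (0 : ℝ) 1, (extend y.deriv.val x).im = 0 := by
    intro x hx
    have h1 := hc.integral_hasStrictDerivAt 0 x
    refine h1.hasDerivAt.unique ((hasDerivAt_const x (0 : ℝ)).congr_of_eventuallyEq ?_)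
    filter_upwards [Ioo_mem_nhds hx.1 hx.2] with t ht
    exact hzero t (Ioo_subset_Icc_self ht)
  -- Differentiation works in the interior only; continuity settles the endpoints.
  have hcl : closure (Ioo (0 : ℝ) 1) ⊆ {x | (extend y.deriv.val x).im = 0} :=
    closure_minimal hIoo (isClosed_eq hc continuous_const)
  rw [closure_Ioo zero_ne_one] at hcl
  intro x
  have := hcl x.2
  rwa [mem_ofPred_eq, extend_coe] at this

/-- Integration by parts in the pairing of a continuous function with a primitive. -/
lemma re_ofContinuous_primitive (f : C(unitInterval, ℝ)) (v : W21) :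
    (ofContinuous f (W22.primitive v 0)).re = ∫ x in (0 : ℝ)..1,
      (extend v.val x).re * ∫ t in x..1, IccExtend zero_le_one f t := by
  have hf : Continuous (IccExtend (zero_le_one (α := ℝ)) f) := f.continuous.Icc_extend'
  have hv : Continuous fun t => (extend v.val t).re :=
    Complex.continuous_re.comp (continuous_extend _)
  have hcont : Continuous fun x => ((IccExtend zero_le_one (f : unitInterval → ℝ) x : ℝ) : ℂ) *
      conj (extend (W22.primitive v 0).val x) :=
    (Complex.continuous_ofReal.comp hf).mul (Complex.continuous_conj.comp (continuous_extend _))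
  rw [ofContinuous_apply, re_intervalIntegral hcont]
  have h1 : ∫ x in (0 : ℝ)..1, (((IccExtend zero_le_one (f : unitInterval → ℝ) x : ℝ) : ℂ) *
      conj (extend (W22.primitive v 0).val x)).re =
      ∫ x in (0 : ℝ)..1, (∫ t in (0 : ℝ)..x, (extend v.val t).re) * IccExtend zero_le_one f x := by
    refine intervalIntegral.integral_congr fun x hx => ?_
    rw [uIcc_of_le zero_le_one] at hx
    have h2 : extend (W22.primitive v 0).val x = 0 + ∫ t in (0 : ℝ)..x, extend v.val t :=
      extend_coe (W22.primitive v 0).val ⟨x, hx⟩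
    simp only [Complex.re_ofReal_mul, Complex.conj_re, h2, zero_add]
    rw [re_intervalIntegral (continuous_extend _), mul_comm]
  -- With this primitive of `f` both boundary terms vanish: it is `0` at `1`, and the test function
  -- is `0` at `0`.
  have hG : ∀ x, HasDerivAt (fun x => -∫ t in x..1, IccExtend zero_le_one f t)
      (IccExtend zero_le_one f x) x := fun x => by
    have := (intervalIntegral.integral_hasDerivAt_left (hf.intervalIntegrable x 1)
      (hf.stronglyMeasurableAtFilter _ _) hf.continuousAt).neg
    rwa [neg_neg] at this
  have hz : ∀ x, HasDerivAt (fun x => ∫ t in (0 : ℝ)..x, (extend v.val t).re)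
      (extend v.val x).re x := fun x => (hv.integral_hasStrictDerivAt 0 x).hasDerivAt
  rw [h1, intervalIntegral.integral_mul_deriv_eq_deriv_mul (fun x _ => hz x) (fun x _ => hG x)
    (hv.intervalIntegrable _ _) (hf.intervalIntegrable _ _)]
  simp

/-- `W22.primitive 0 1` is the constant `1`; pairing with it reads off the tail integral at `0`. -/
lemma re_ofContinuous_one (f : C(unitInterval, ℝ)) :
    (ofContinuous f (W22.primitive 0 1)).re = ∫ t in (0 : ℝ)..1, IccExtend zero_le_one f t := by
  have h : ∀ x, extend (W22.primitive 0 1).val x = 1 := fun x => by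
    change (1 : ℂ) + ∫ t in (0 : ℝ)..(projIcc 0 1 zero_le_one x : unitInterval),
      extend (W21.val 0) t = 1
    simp [extend, IccExtend]
  simp only [ofContinuous_apply, h, map_one, mul_one]
  rw [intervalIntegral.integral_ofReal, Complex.ofReal_re]

lemma W21.starMul_zero (u : W21) : u.starMul 0 = 0 := by
  refine W21.ext (fun x => ?_) ?_
  · rw [W21.starMul_val]
    simp
  · have h0 : ⇑(W21.deriv 0) =ᵐ[lebesgue01] 0 := by
      rw [map_zero]
      exact Lp.coeFn_zero _ _ _
    filter_upwards [u.starMul_deriv_ae 0, h0] with t h1 h2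
    rw [h1, h2]
    simp [extend, IccExtend]

/-- The product of a function with a cut-off of it is the square of the cut-off. -/
lemma W21.starMul_cutoff {u v : W21} {s : Set ℝ}
    (hv : ∀ x, extend v.val x = s.indicator (extend u.val) (projIcc 0 1 zero_le_one x))
    (hd : v.deriv =ᵐ[lebesgue01] s.indicator u.deriv) : u.starMul v = v.starMul v := by
  have hmem : ∀ᵐ x ∂lebesgue01, x ∈ Icc (0 : ℝ) 1 := ae_restrict_mem measurableSet_Icc
  refine W21.ext (fun x => ?_) ?_
  · rw [W21.starMul_val, W21.starMul_val, ← extend_coe, ← extend_coe v.val, hv]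
    simp only [projIcc_val]
    by_cases hx : (x : ℝ) ∈ s <;> simp [hx]
  · filter_upwards [u.starMul_deriv_ae v, v.starMul_deriv_ae v, hd, hmem] with t h1 h2 h3 ht
    rw [h1, h2, h3, hv, projIcc_of_mem _ ht]
    by_cases hx : t ∈ s <;> simp [hx]

end SignReg

end

/-! ### Transfer of the alternation from `y` to functions near `Ly` -/

open SignReg in
theorem mainTheorem3
    (p : ℝ → ℝ) (hp : MemLp p ∞ lebesgue01) (hp_pos : ∃ c > 0, ∀ᵐ x ∂lebesgue01, c ≤ p x)
    (q : W21Dual) (hq : IsRealDistribution q) (α : ℝ) (hα : 0 < α)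
    (L : W22 →L[ℂ] W22Dual)
    (hL : ∀ y z : W22, L y z =
      (∫ x in (0 : ℝ)..1, (p x : ℂ) * y.deriv2 x * conj (z.deriv2 x)) +
        q (y.deriv.starMul z.deriv) + (α : ℂ) * y.val 0 * conj (z.val 0))
    (hpos : ∀ y : W22, y ≠ 0 → 0 < (L y y).re) :
    DoesNotDecreaseSignChanges L := by
  intro y hy
  refine le_iInf₂ fun n hn => iInf₂_le n ?_
  by_contra hcon
  obtain ⟨s, hs⟩ := exists_alternates_of_not_atMostSignChanges hcon
  change Alternates (n + 1) s (rePart y.val) at hs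
  -- A constant test function leaves only the boundary term.
  have hone : (L y (W22.primitive 0 1)).re = α * rePart y.val 0 := by
    rw [hL, W22.primitive_deriv, W21.starMul_zero, W22.primitive_val_zero]
    have h0 : ⇑(W22.primitive 0 1).deriv2 =ᵐ[lebesgue01] 0 := by
      change ⇑(W21.deriv 0) =ᵐ[lebesgue01] 0
      rw [map_zero]
      exact Lp.coeFn_zero _ _ _
    rw [intervalIntegral.integral_of_le zero_le_one, ← integral_Icc_eq_integral_Ioc,
      integral_eq_zero_of_ae (by filter_upwards [h0] with t ht; simp [ht])]
    simp [rePart]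
  have hreal : ∀ x, IccExtend zero_le_one (rePart y.deriv.val) x = 0 →
      extend y.deriv.val x = 0 := fun x hx => Complex.ext hx (hy.deriv _)
  -- The functionals near `L y` inherit the alternation of `y'`.
  have near : ∀ m s', Alternates m s' (rePart y.deriv.val) →
      ∀ᶠ F in nhds (L y), ∀ f : C(unitInterval, ℝ), ofContinuous f = F →
        Alternates m s' fun x => ∫ t in (x : ℝ)..1, IccExtend zero_le_one f t := by
    intro m s' h
    obtain ⟨c, d, hdc, hI⟩ := h.exists_nodal_intervals
    have key : ∀ k ≤ m, ∃ v : W21, (∀ x, extend v.val x = (Icc (c k) (d k)).indicator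
        (extend y.deriv.val) (projIcc 0 1 zero_le_one x)) ∧
        0 < (L y (W22.primitive v 0)).re := by
      intro k hk
      obtain ⟨h0, hcd, h1, hc, hd, hne⟩ := hI k hk
      obtain ⟨v, hv, hvd⟩ := y.deriv.exists_cutoff h0 hcd h1 (hc.imp_right (hreal _))
        (hd.imp_right (hreal _))
      refine ⟨v, hv, ?_⟩
      -- On the support of the cut-off `y'` may be replaced by `v`, and the boundary term is zero on
      -- both sides.
      have heq : L y (W22.primitive v 0) = L (W22.primitive v 0) (W22.primitive v 0) := by
        have hi : ∫ x in (0 : ℝ)..1, (p x : ℂ) * y.deriv2 x * conj ((W22.primitive v 0).deriv2 x) =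
            ∫ x in (0 : ℝ)..1, (p x : ℂ) * (W22.primitive v 0).deriv2 x *
              conj ((W22.primitive v 0).deriv2 x) := by
          simp only [intervalIntegral.integral_of_le zero_le_one, ← integral_Icc_eq_integral_Ioc]
          refine integral_congr_ae ?_
          filter_upwards [hvd] with t ht
          change (p t : ℂ) * y.deriv.deriv t * conj (v.deriv t) =
            (p t : ℂ) * v.deriv t * conj (v.deriv t)
          rw [ht]
          by_cases hx : t ∈ Icc (c k) (d k) <;> simp [hx]
        rw [hL, hL, hi, W22.primitive_deriv, W21.starMul_cutoff hv hvd, W22.primitive_val_zero]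
        simp
      rw [heq]
      -- The cut-off is not zero, because `y'` has no zeros inside its nodal interval.
      refine hpos _ fun hz => ?_
      obtain ⟨x, hx⟩ := exists_between hcd
      have hv0 : v = 0 := by
        rw [← W22.primitive_deriv v 0, hz, map_zero]
      have hx01 : x ∈ Icc (0 : ℝ) 1 := ⟨h0.trans hx.1.le, hx.2.le.trans h1⟩
      have hvx := hv x
      rw [projIcc_of_mem _ hx01, indicator_of_mem (Ioo_subset_Icc_self hx), hv0] at hvx
      have hnex := hne x hx
      rw [extend_rePart, ← hvx] at hnex
      simp [SignReg.extend, IccExtend] at hnex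
    choose! v hv hvpos using key
    have hev : ∀ᶠ F in nhds (L y), ∀ k ∈ Finset.range (m + 1),
        0 < (F (W22.primitive (v k) 0)).re := by
      refine (Finset.eventually_all _).2 fun k hk => ?_
      have hc : Continuous fun F : W22Dual => (F (W22.primitive (v k) 0)).re := by fun_prop
      exact hc.continuousAt.eventually
        (lt_mem_nhds (hvpos k (Nat.lt_succ_iff.1 (Finset.mem_range.1 hk))))
    filter_upwards [hev] with F hF f hf
    -- The weight is `y'` with its sign on the `k`-th nodal interval corrected; the sign factor then
    -- enters squared.
    refine alternates_of_integral
      (fun k x => s' * (-1) ^ k * IccExtend zero_le_one (rePart y.deriv.val) x) c d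
      (fun k hk => (hI k hk).1) (fun k hk => (hI k hk).2.2.1) (fun k hk => (hI k hk).2.1.le) hdc
      (fun k hk x hx => ((hI k hk).2.2.2.2.2 x hx).le) fun k hk => ?_
    obtain ⟨h0, hcd, h1, -, -, hne⟩ := hI k hk
    have hFk := hF k (Finset.mem_range.2 (Nat.lt_succ_iff.2 hk))
    have ht : s' * (-1) ^ k ≠ 0 := by
      obtain ⟨x, hx⟩ := exists_between hcd
      exact left_ne_zero_of_mul (hne x hx).ne'
    rw [← hf, re_ofContinuous_primitive] at hFk
    have hcut : ∫ x in (0 : ℝ)..1, (extend (v k).val x).re *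
        ∫ t in x..1, IccExtend zero_le_one f t =
        ∫ x in Icc (c k) (d k), (extend y.deriv.val x).re *
          ∫ t in x..1, IccExtend zero_le_one f t := by
      rw [intervalIntegral.integral_of_le zero_le_one, ← integral_Icc_eq_integral_Ioc,
        ← inter_eq_self_of_subset_right (Icc_subset_Icc h0 h1 : Icc (c k) (d k) ⊆ Icc 0 1),
        ← setIntegral_indicator measurableSet_Icc]
      refine setIntegral_congr_fun measurableSet_Icc fun x hx => ?_
      rw [hv k hk, projIcc_of_mem _ hx]
      by_cases hx' : x ∈ Icc (c k) (d k) <;> simp [hx']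
    rw [hcut] at hFk
    have hscale : ∫ x in c k..d k, s' * (-1) ^ k * IccExtend zero_le_one (rePart y.deriv.val) x *
        (s' * (-1) ^ k * IccExtend zero_le_one
          (fun x : unitInterval => ∫ t in (x : ℝ)..1, IccExtend zero_le_one f t) x) =
        (s' * (-1) ^ k) ^ 2 * ∫ x in Icc (c k) (d k), (extend y.deriv.val x).re *
          ∫ t in x..1, IccExtend zero_le_one f t := by
      rw [intervalIntegral.integral_of_le hcd.le, ← integral_Icc_eq_integral_Ioc,
        ← integral_const_mul]
      refine setIntegral_congr_fun measurableSet_Icc fun x hx => ?_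
      have hx01 : x ∈ Icc (0 : ℝ) 1 := ⟨h0.trans hx.1, hx.2.trans h1⟩
      rw [extend_rePart, IccExtend_of_mem _ _ hx01]
      ring
    rw [hscale]
    positivity
  have hev : ∀ᶠ F in nhds (L y), ∀ f : C(unitInterval, ℝ), ofContinuous f = F →
      Alternates (n + 1) s fun x => ∫ t in (x : ℝ)..1, IccExtend zero_le_one f t := by
    -- In the first case `y'` already alternates `n + 1` times from the sign `s`; in the second only
    -- `n` times from `-s`, and the point `0` is added.
    rcases le_or_gt (s * rePart y.val 0) 0 with h0 | h0
    · exact near _ _ (hs.of_primitive_of_nonpos y.re_val_eq h0)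
    · have hc : Continuous fun F : W22Dual => s * (F (W22.primitive 0 1)).re := by fun_prop
      have h1 : 0 < s * (L y (W22.primitive 0 1)).re := by
        rw [hone]
        nlinarith [mul_pos hα h0]
      filter_upwards [near _ _ (hs.of_primitive y.re_val_eq),
        hc.continuousAt.eventually (lt_mem_nhds h1)] with F hF1 hF2 f hf
      refine (hF1 f hf).cons ?_
      rw [← hf, re_ofContinuous_one] at hF2
      exact hF2
  obtain ⟨F, hF, f, hfn, hf⟩ := mem_closure_iff_nhds.1 hn _ hev
  exact (hF f hf).of_tail_integral.not_atMostSignChanges hfn
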